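/- All Hilbert spaces are complex and finite-dimensional; $L(\mathcal H)$ denotes the linear operators on $\mathcal H$. A quantum statistical model $R=(\Theta,\mathcal H,\rho)$ consists of a finite non-empty parameter set $\Theta$, a Hilbert space $\mathcal H$ and a family $\rho=(\rho_\theta)_{\theta\in\Theta}$ of density matrices on $\mathcal H$ (positive semidefinite operators of trace one). For a finite non-empty decision set $\mathcal X$ and a payoff function $\ell:\Theta\times\mathcal X\to\mathbb R$, its maximum expected payoff is $$\$_q(R,\mathcal X,\ell)=\max_{P}\ \frac1{|\Theta|}\sum_{\theta\in\Theta}\sum_{i\in\mathcal X}\ell(\theta,i)\,\mathrm{Tr}[\rho_\theta P^i],$$ where the maximum is over all POVMs $P=(P^i)_{i\in\mathcal X}$ on $\mathcal H$, i.e. families with $P^i\ge 0$ and $\sum_i P^i=\mathbb 1$. For models $R$ and $S$ with the same parameter set, $R$ is more informative than $S$, written $R\supset S$, if $\$_q(R,\mathcal X,\ell)\ge \$_q(S,\mathcal X,\ell)$ for every finite non-empty $\mathcal X$ and every $\ell$. For a model $T=(\Xi,\mathcal K,\tau)$, the composition $T\times R$ is the model $(\Xi\times\Theta,\ \mathcal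 K\otimes\mathcal H,\ (\tau_\xi\otimes\rho_\theta)_{\xi\in\Xi,\theta\in\Theta})$. The model $T$ is complete if $\{\tau_\xi:\xi\in\Xi\}$ contains $(\dim\mathcal K)^2$ linearly independent density matrices. **Proposition.** Let $R=(\Theta,\mathcal H,\rho)$ and $S=(\Theta,\mathcal H',\sigma)$ be quantum statistical models with the same parameter set. The following are equivalent: 1. there is a completely positive trace-preserving linear map $\mathcal E:L(\mathcal H)\to L(\mathcal H')$ with $\mathcal E(\rho_\theta)=\sigma_\theta$ for all $\theta\in\Theta$ (that is, $R$ is sufficient for $S$); 2. $T\times R\supset T\times S$ for every quantum statistical model $T=(\Xi,\mathcal K,\tau)$; 3. $T\times R\supset T\times S$ for some complete quantum statistical model $T=(\Xi,\mathcal K,\tau)$ with $\mathcal K\cong\mathcal H'$. -/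

import Mathlib

open scoped Matrix Kronecker ComplexOrder MatrixOrder Matrix.Norms.L2Operator CStarAlgebra

/-- A quantum statistical model with finite non-empty parameter set `Θ` on the finite-dimensional
Hilbert space with orthonormal basis indexed by `n` (so that operators are identified with their
matrices): a family of density matrices, i.e. positive semidefinite matrices of trace one. -/
structure QuantumStatisticalModel (Θ n : Type*) [Fintype Θ] [Fintype n] where
  param_nonempty : Nonempty Θ
  state : Θ → Matrix n n ℂ
  posSemidef : ∀ θ, (state θ).PosSemidef
  trace_eq_one : ∀ θ, (state θ).trace = 1

/-- `P` is a positive-operator-valued measure with finite outcome set `X`. -/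
structure IsPOVM {X n : Type*} [Fintype X] [Fintype n] [DecidableEq n]
    (P : X → Matrix n n ℂ) : Prop where
  posSemidef : ∀ i, (P i).PosSemidef
  sum_eq_one : ∑ i, P i = 1

/-- A state space `S` on an `n`-dimensional Hilbert space is complete if it contains `n ^ 2`
linearly independent density matrices. -/
def IsCompleteStateSpace {n : Type*} [Fintype n] (S : Set (Matrix n n ℂ)) : Prop :=
  ∃ f : Fin (Fintype.card n ^ 2) → Matrix n n ℂ, (∀ j, f j ∈ S) ∧ LinearIndependent ℂ f

namespace QuantumStatisticalModel

variable {Θ Ξ n m k : Type*} [Fintype Θ] [Fintype Ξ] [Fintype n] [Fintype m] [Fintype k]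

/-- The expected payoff of the strategy `P` in the decision problem with payoff function `ℓ`,
for the uniform prior on the parameter set. The traces are real for every POVM `P`. -/
noncomputable def expectedPayoff (R : QuantumStatisticalModel Θ n) {X : Type*} [Fintype X]
    (ℓ : Θ → X → ℝ) (P : X → Matrix n n ℂ) : ℝ :=
  (1 / (Fintype.card Θ : ℝ)) * ∑ θ, ∑ i, ℓ θ i * ((R.state θ * P i).trace).re

/-- The maximum expected payoff over all POVMs; the supremum is attained for every non-empty
decision set, see `maxPayoff_isGreatest`. -/
noncomputable def maxPayoff [DecidableEq n] (R : QuantumStatisticalModel Θ n)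
    {X : Type*} [Fintype X] (ℓ : Θ → X → ℝ) : ℝ :=
  sSup {s : ℝ | ∃ P : X → Matrix n n ℂ, IsPOVM P ∧ s = R.expectedPayoff ℓ P}

theorem maxPayoff_isGreatest [DecidableEq n] (R : QuantumStatisticalModel Θ n)
    {X : Type*} [Fintype X] [Nonempty X] (ℓ : Θ → X → ℝ) :
    IsGreatest {s : ℝ | ∃ P : X → Matrix n n ℂ, IsPOVM P ∧ s = R.expectedPayoff ℓ P}
      (R.maxPayoff ℓ) := by
  classical
  have himg : {s : ℝ | ∃ P : X → Matrix n n ℂ, IsPOVM P ∧ s = R.expectedPayoff ℓ P} =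
      R.expectedPayoff ℓ '' {P : X → Matrix n n ℂ | IsPOVM P} := by
    ext s
    simp only [Set.mem_ofPred_eq, Set.mem_image]
    exact ⟨fun ⟨P, h, e⟩ => ⟨P, h, e.symm⟩, fun ⟨P, h, e⟩ => ⟨P, h, e.symm⟩⟩
  have hset : {P : X → Matrix n n ℂ | IsPOVM P} =
      (⋂ i, {P | 0 ≤ P i}) ∩ {P | ∑ i, P i = 1} := by
    ext P
    simp only [Set.mem_inter_iff, Set.mem_iInter, Set.mem_ofPred_eq, Matrix.nonneg_iff_posSemidef]
    exact ⟨fun h => ⟨h.1, h.2⟩, fun h => ⟨h.1, h.2⟩⟩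
  have hclosed : IsClosed {P : X → Matrix n n ℂ | IsPOVM P} := by
    rw [hset]
    refine (isClosed_iInter fun i => ?_).inter ?_
    · have hc : IsClosed {A : Matrix n n ℂ | 0 ≤ A} := CStarAlgebra.isClosed_nonneg
      have hi : Continuous fun P : X → Matrix n n ℂ => P i := continuous_apply i
      exact hc.preimage hi
    · exact isClosed_eq (by fun_prop) continuous_const
  have hcomp : IsCompact {P : X → Matrix n n ℂ | IsPOVM P} := by
    have : ProperSpace (Matrix n n ℂ) := FiniteDimensional.proper ℂ _
    refine Metric.isCompact_of_isClosed_isBounded hclosed ?_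
    refine (Metric.isBounded_closedBall (x := (0 : X → Matrix n n ℂ)) (r := 1)).subset ?_
    intro P hP
    rw [mem_closedBall_zero_iff, pi_norm_le_iff_of_nonneg zero_le_one]
    intro i
    have h0 : ∀ j, 0 ≤ P j := fun j => Matrix.nonneg_iff_posSemidef.2 (hP.1 j)
    have h1 : P i ≤ 1 := by
      rw [← hP.2]
      exact Finset.single_le_sum (fun j _ => h0 j) (Finset.mem_univ i)
    exact (CStarAlgebra.norm_le_one_iff_of_nonneg (P i) (h0 i)).2 h1
  have hne : {P : X → Matrix n n ℂ | IsPOVM P}.Nonempty := by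
    obtain ⟨x⟩ := ‹Nonempty X›
    refine ⟨fun i => if i = x then 1 else 0, fun i => ?_, by simp⟩
    by_cases h : i = x
    · simpa [h] using Matrix.PosSemidef.one
    · simpa [h] using Matrix.PosSemidef.zero
  have hcont : Continuous (R.expectedPayoff (X := X) ℓ) := by
    unfold expectedPayoff
    fun_prop
  unfold maxPayoff
  rw [himg]
  exact (hcomp.image hcont).isGreatest_sSup (hne.image _)

/-- `R` is always more informative than `S`: for every finite (non-empty) decision set and every
payoff function, the maximum expected payoff of `R` is at least that of `S`. -/
def MoreInformative [DecidableEq n] [DecidableEq m] (R : QuantumStatisticalModel Θ n)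
    (S : QuantumStatisticalModel Θ m) : Prop :=
  ∀ (X : Type) [Fintype X] [Nonempty X] (ℓ : Θ → X → ℝ), S.maxPayoff ℓ ≤ R.maxPayoff ℓ

/-- `R` is sufficient for `S`: a completely positive trace-preserving map sends each state of `R`
to the corresponding state of `S`. -/
def SufficientFor [DecidableEq n] [DecidableEq m] (R : QuantumStatisticalModel Θ n)
    (S : QuantumStatisticalModel Θ m) : Prop :=
  ∃ E : Matrix n n ℂ →CP Matrix m m ℂ,
    (∀ A, (E A).trace = A.trace) ∧ ∀ θ, E (R.state θ) = S.state θ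

/-- The composition of two models: the tensor products of their states. -/
def comp (T : QuantumStatisticalModel Ξ k) (R : QuantumStatisticalModel Θ n) :
    QuantumStatisticalModel (Ξ × Θ) (k × n) where
  param_nonempty :=
    haveI := T.param_nonempty
    haveI := R.param_nonempty
    inferInstance
  state p := T.state p.1 ⊗ₖ R.state p.2
  posSemidef p := (T.posSemidef p.1).kronecker (R.posSemidef p.2)
  trace_eq_one p := by
    rw [Matrix.trace_kronecker, T.trace_eq_one, R.trace_eq_one, one_mul]

/-- A model is complete if the set of its states is a complete state space. -/
def IsComplete (T : QuantumStatisticalModel Ξ k) : Prop :=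
  IsCompleteStateSpace (Set.range T.state)

end QuantumStatisticalModel

/-! A channel from `R` to `S` acts dually on measurements: pulling a POVM back along `id ⊗ E†` keeps
its payoff, and the result is again a POVM (`IsPOVM.linkProduct_choiMatrix`). This gives 1 → 2, and
2 → 3 only needs a complete model. For 3 → 1, attainable statistics form a compact convex set, so
Hahn–Banach separation turns the comparison of payoffs into a POVM `P` on `T × R` reproducing the
statistics of the Bell measurement on `T × S`. Completeness extends the agreement from the states of
`T` to every operator on the first factor. Now run teleportation with `P` in place of the Bell
measurement: measure `P` on half of a maximally entangled pair and the input, then correct the other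
half. Its output depends only on the statistics of `P`, and genuine teleportation of `σ_θ` returns
`σ_θ`; hence `ρ_θ` is sent to `σ_θ`. -/

/-! ### Positivity of bipartite and block matrices. -/

section Positivity

variable {a b c n m : Type*} [Fintype c]

/-- The contraction of two bipartite matrices over their common second factor. -/
def linkProduct (M : Matrix (a × c) (a × c) ℂ) (N : Matrix (b × c) (b × c) ℂ) :
    Matrix (a × b) (a × b) ℂ :=
  fun p q => ∑ z, ∑ z', M (p.1, z) (q.1, z') * N (p.2, z) (q.2, z')

/-- This is `M ⊗ₖ N` compressed by the unnormalised entangled vector `∑ z, e_z ⊗ e_z` on the two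
copies of `c`; `V` carries out the sum. -/
theorem Matrix.PosSemidef.linkProduct [Fintype a] [Fintype b]
    {M : Matrix (a × c) (a × c) ℂ} {N : Matrix (b × c) (b × c) ℂ}
    (hM : M.PosSemidef) (hN : N.PosSemidef) : (linkProduct M N).PosSemidef := by
  classical
  let X : Matrix ((a × b) × c) ((a × b) × c) ℂ :=
    (M ⊗ₖ N).submatrix (fun p => ((p.1.1, p.2), (p.1.2, p.2))) fun p => ((p.1.1, p.2), (p.1.2, p.2))
  let V : Matrix ((a × b) × c) (a × b) ℂ := Matrix.of fun p q => if p.1 = q then 1 else 0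
  have hX : X.PosSemidef := (hM.kronecker hN).submatrix _
  have h : _root_.linkProduct M N = Vᴴ * X * V := by
    ext p q
    simp only [Matrix.mul_apply, Matrix.conjTranspose_apply, V, Matrix.of_apply,
      Fintype.sum_prod_type_right (α₁ := a × b), apply_ite star, star_one, star_zero, mul_ite,
      ite_mul, one_mul, zero_mul, mul_one, mul_zero, Finset.sum_ite_eq', Finset.mem_univ, if_true]
    exact Finset.sum_comm
  exact h ▸ hX.conjTranspose_mul_mul_same V

theorem Matrix.PosSemidef.mul_mul_star [Fintype n] {A : Matrix n n ℂ} (hA : A.PosSemidef)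
    (f : n → ℂ) : (Matrix.of fun p q => f p * A p q * star (f q)).PosSemidef := by
  classical
  have h := hA.mul_mul_conjTranspose_same (Matrix.diagonal f)
  convert h using 1
  ext p q
  simp [Matrix.diagonal_conjTranspose, Matrix.mul_diagonal, Matrix.diagonal_mul]

theorem Matrix.PosSemidef.trace_mul_im_eq_zero [Fintype n] {A B : Matrix n n ℂ}
    (hA : A.PosSemidef) (hB : B.PosSemidef) : (A * B).trace.im = 0 := by
  rw [← Complex.conj_eq_iff_im]
  change star _ = _
  rw [← Matrix.trace_conjTranspose, Matrix.conjTranspose_mul, hA.1.eq, hB.1.eq,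
    Matrix.trace_mul_comm]

/-- Flattening blocks respects `star N * N`, and such elements generate both cones. It links the
order in the definition of `→CP` to ordinary matrices. -/
theorem CStarMatrix.nonneg_iff_posSemidef_comp {k : Type*} [Fintype k] [Fintype n] [DecidableEq n]
    (M : CStarMatrix k k (Matrix n n ℂ)) :
    0 ≤ M ↔ (Matrix.comp k k n n ℂ (CStarMatrix.ofMatrix.symm M)).PosSemidef := by
  classical
  have hstar : ∀ N : CStarMatrix k k (Matrix n n ℂ),
      Matrix.comp k k n n ℂ (CStarMatrix.ofMatrix.symm (star N * N)) =
        (Matrix.comp k k n n ℂ (CStarMatrix.ofMatrix.symm N))ᴴ *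
          Matrix.comp k k n n ℂ (CStarMatrix.ofMatrix.symm N) := by
    intro N
    ext ⟨i, x⟩ ⟨j, y⟩
    change ((star N * N) i j) x y = _
    rw [CStarMatrix.mul_apply]
    simp only [Matrix.sum_apply, Matrix.mul_apply, Fintype.sum_prod_type]
    rfl
  constructor
  · intro hM
    rw [StarOrderedRing.nonneg_iff] at hM
    induction hM using AddSubmonoid.closure_induction with
    | mem _ h =>
      obtain ⟨N, rfl⟩ := h
      change (Matrix.comp k k n n ℂ (CStarMatrix.ofMatrix.symm (star N * N))).PosSemidef
      rw [hstar]
      exact Matrix.posSemidef_conjTranspose_mul_self _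
    | zero => exact Matrix.PosSemidef.zero
    | add _ _ _ _ h₁ h₂ => exact h₁.add h₂
  · intro hM
    obtain ⟨B, hB⟩ := CStarAlgebra.nonneg_iff_eq_star_mul_self.1 hM.nonneg
    have hMB : M = star (CStarMatrix.ofMatrix ((Matrix.comp k k n n ℂ).symm B)) *
        CStarMatrix.ofMatrix ((Matrix.comp k k n n ℂ).symm B) := by
      apply (CStarMatrix.ofMatrix.symm.trans (Matrix.comp k k n n ℂ)).injective
      rw [Equiv.trans_apply, Equiv.trans_apply, hstar, hB]
      simp [Matrix.star_eq_conjTranspose]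
    rw [hMB]
    exact star_mul_self_nonneg _

end Positivity

/-! ### Choi matrices and complete positivity. -/

section Choi

variable {k n m : Type*} [Fintype n] [Fintype m]

/-- The linear map whose (partially transposed) Choi matrix is `C`. -/
def linearMapOfChoi (C : Matrix (m × n) (m × n) ℂ) : Matrix n n ℂ →ₗ[ℂ] Matrix m m ℂ where
  toFun A := Matrix.of fun y y' => ∑ z, ∑ z', A z z' * C (y, z) (y', z')
  map_add' A B := by
    ext
    simp [add_mul, Finset.sum_add_distrib]
  map_smul' c A := by
    ext
    simp [mul_assoc, Finset.mul_sum]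

/-- The completely positive map with positive semidefinite Choi matrix `C`. -/
noncomputable def completelyPositiveMapOfChoi [DecidableEq n] [DecidableEq m]
    (C : Matrix (m × n) (m × n) ℂ) (hC : C.PosSemidef) : Matrix n n ℂ →CP Matrix m m ℂ where
  toLinearMap := linearMapOfChoi C
  map_cstarMatrix_nonneg' k M hM := by
    rw [CStarMatrix.nonneg_iff_posSemidef_comp] at hM ⊢
    -- The amplified map, once flattened, is by definition the link product with `C`.
    exact hM.linkProduct hC

/-- The Choi matrix of a linear map. -/
def choiMatrix [DecidableEq n] (E : Matrix n n ℂ → Matrix m m ℂ) :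
    Matrix (n × m) (n × m) ℂ :=
  Matrix.of fun p q => E (Matrix.single p.1 q.1 1) p.2 q.2

/-- The block matrix of matrix units flattens to a rank-one positive matrix; its image is the Choi
matrix. -/
theorem CompletelyPositiveMap.posSemidef_choiMatrix [DecidableEq n] [DecidableEq m]
    (E : Matrix n n ℂ →CP Matrix m m ℂ) : (choiMatrix E).PosSemidef := by
  let M : CStarMatrix n n (Matrix n n ℂ) :=
    CStarMatrix.ofMatrix (Matrix.of fun z z' => Matrix.single z z' 1)
  have hM : 0 ≤ M := by
    rw [CStarMatrix.nonneg_iff_posSemidef_comp]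
    convert Matrix.posSemidef_vecMulVec_self_star
      (fun p : n × n => if p.1 = p.2 then (1 : ℂ) else 0) using 1
    ext ⟨i, x⟩ ⟨j, y⟩
    by_cases h₁ : i = x <;> by_cases h₂ : j = y <;>
      simp [M, Matrix.vecMulVec_apply, h₁, h₂]
  exact (CStarMatrix.nonneg_iff_posSemidef_comp _).1 (E.map_cstarMatrix_nonneg M hM)

omit [Fintype m] in
theorem map_apply_eq_sum_choiMatrix [DecidableEq n] {F : Type*}
    [FunLike F (Matrix n n ℂ) (Matrix m m ℂ)] [LinearMapClass F ℂ (Matrix n n ℂ) (Matrix m m ℂ)]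
    (E : F) (A : Matrix n n ℂ) (y y' : m) :
    E A y y' = ∑ z, ∑ z', A z z' * choiMatrix E (z, y) (z', y') := by
  conv_lhs => rw [Matrix.matrix_eq_sum_single A]
  simp only [map_sum, Matrix.sum_apply, choiMatrix, Matrix.of_apply]
  refine Finset.sum_congr rfl fun z _ => Finset.sum_congr rfl fun z' _ => ?_
  have : Matrix.single z z' (A z z') = A z z' • Matrix.single z z' (1 : ℂ) := by simp
  rw [this, map_smul, Matrix.smul_apply, smul_eq_mul]

end Choi

/-! ### Duality and pulled-back measurements. -/

section Trace

variable {k n m : Type*} [Fintype k] [Fintype n] [Fintype m]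

theorem trace_kronecker_mul (A : Matrix k k ℂ) (B : Matrix n n ℂ)
    (P : Matrix (k × n) (k × n) ℂ) :
    ((A ⊗ₖ B) * P).trace =
      ∑ x, ∑ x', A x x' * ∑ z, ∑ z', B z z' * P (x', z') (x, z) := by
  simp only [Matrix.trace, Matrix.diag_apply, Matrix.mul_apply, Fintype.sum_prod_type,
    Matrix.kroneckerMap_apply, Finset.mul_sum, mul_assoc]
  exact Finset.sum_congr rfl fun x _ => Finset.sum_comm

/-- The link product on the right is `(id ⊗ E†) Q`; the trace pairing causes the transpose. -/
theorem trace_kronecker_map_mul [DecidableEq n] {F : Type*}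
    [FunLike F (Matrix n n ℂ) (Matrix m m ℂ)] [LinearMapClass F ℂ (Matrix n n ℂ) (Matrix m m ℂ)]
    (E : F) (A : Matrix k k ℂ) (B : Matrix n n ℂ) (Q : Matrix (k × m) (k × m) ℂ) :
    ((A ⊗ₖ E B) * Q).trace = ((A ⊗ₖ B) * linkProduct Q (choiMatrix E)ᵀ).trace := by
  rw [trace_kronecker_mul, trace_kronecker_mul]
  refine Finset.sum_congr rfl fun x _ => Finset.sum_congr rfl fun x' _ => ?_
  congr 1
  simp only [map_apply_eq_sum_choiMatrix, linkProduct, Matrix.transpose_apply, Finset.mul_sum,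
    Finset.sum_mul]
  rw [Finset.sum_congr rfl fun y _ => Finset.sum_comm, Finset.sum_comm]
  refine Finset.sum_congr rfl fun z _ => ?_
  rw [Finset.sum_congr rfl fun y _ => Finset.sum_comm, Finset.sum_comm]
  refine Finset.sum_congr rfl fun z' _ => ?_
  rw [Finset.sum_comm]
  refine Finset.sum_congr rfl fun y _ => Finset.sum_congr rfl fun y' _ => ?_
  ring

end Trace

namespace IsPOVM

variable {X k n m : Type*} [Fintype X] [Fintype k] [Fintype n] [Fintype m]
  [DecidableEq k] [DecidableEq n] [DecidableEq m]

theorem linkProduct_choiMatrix {Q : X → Matrix (k × m) (k × m) ℂ} (hQ : IsPOVM Q)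
    (E : Matrix n n ℂ →CP Matrix m m ℂ) (hE : ∀ A, (E A).trace = A.trace) :
    IsPOVM fun i => linkProduct (Q i) (choiMatrix E)ᵀ where
  posSemidef i := (hQ.posSemidef i).linkProduct E.posSemidef_choiMatrix.transpose
  sum_eq_one := by
    ext ⟨x', z'⟩ ⟨x, z⟩
    have hsum : ∀ p q, ∑ i, Q i p q = if p = q then 1 else 0 := fun p q => by
      rw [← Matrix.sum_apply, hQ.sum_eq_one, Matrix.one_apply]
    -- Trace preservation of `E` is unitality of `E†`.
    have htr := hE (Matrix.single z z' 1)
    simp only [Matrix.sum_apply, linkProduct]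
    rw [Finset.sum_comm, Finset.sum_congr rfl fun y _ => Finset.sum_comm]
    simp only [← Finset.sum_mul, hsum, Prod.mk.injEq, Matrix.one_apply, Matrix.transpose_apply,
      choiMatrix, Matrix.of_apply]
    by_cases hx : x' = x
    · simp only [hx, true_and, ite_mul, one_mul, zero_mul, Finset.sum_ite_eq, Finset.mem_univ,
        if_true]
      rw [Matrix.trace] at htr
      simp only [Matrix.diag_apply] at htr
      rw [htr]
      by_cases hz : z' = z
      · subst hz; simp
      · rw [if_neg hz, Matrix.trace_single_eq_of_ne _ _ _ (Ne.symm hz)]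
    · simp [hx]

theorem convex : Convex ℝ {P : X → Matrix n n ℂ | IsPOVM P} := by
  intro P hP Q hQ a b ha hb hab
  refine ⟨fun i => ?_, ?_⟩
  · exact ((hP.posSemidef i).smul ha).add ((hQ.posSemidef i).smul hb)
  · simp only [Pi.add_apply, Pi.smul_apply, Finset.sum_add_distrib, ← Finset.smul_sum,
      hP.sum_eq_one, hQ.sum_eq_one, ← add_smul, hab, one_smul]

theorem isCompact : IsCompact {P : X → Matrix n n ℂ | IsPOVM P} := by
  have hset : {P : X → Matrix n n ℂ | IsPOVM P} =
      (⋂ i, {P | 0 ≤ P i}) ∩ {P | ∑ i, P i = 1} := by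
    ext P
    simp only [Set.mem_inter_iff, Set.mem_iInter, Set.mem_ofPred_eq, Matrix.nonneg_iff_posSemidef]
    exact ⟨fun h => ⟨h.1, h.2⟩, fun h => ⟨h.1, h.2⟩⟩
  have hclosed : IsClosed {P : X → Matrix n n ℂ | IsPOVM P} := by
    rw [hset]
    refine (isClosed_iInter fun i => ?_).inter ?_
    · have hc : IsClosed {A : Matrix n n ℂ | 0 ≤ A} := CStarAlgebra.isClosed_nonneg
      have hi : Continuous fun P : X → Matrix n n ℂ => P i := continuous_apply i
      exact hc.preimage hi
    · exact isClosed_eq (by fun_prop) continuous_const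
  have : ProperSpace (Matrix n n ℂ) := FiniteDimensional.proper ℂ _
  refine Metric.isCompact_of_isClosed_isBounded hclosed ?_
  refine (Metric.isBounded_closedBall (x := (0 : X → Matrix n n ℂ)) (r := 1)).subset ?_
  intro P hP
  rw [mem_closedBall_zero_iff, pi_norm_le_iff_of_nonneg zero_le_one]
  intro i
  have h0 : ∀ j, 0 ≤ P j := fun j => Matrix.nonneg_iff_posSemidef.2 (hP.1 j)
  have h1 : P i ≤ 1 := by
    rw [← hP.2]
    exact Finset.single_le_sum (fun j _ => h0 j) (Finset.mem_univ i)
  exact (CStarAlgebra.norm_le_one_iff_of_nonneg (P i) (h0 i)).2 h1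

end IsPOVM

/-! ### Reproducing statistics, and complete models. -/

namespace QuantumStatisticalModel

variable {Θ Ξ n m k : Type*} [Fintype Θ] [Fintype Ξ] [Fintype n] [Fintype m] [Fintype k]
  [DecidableEq n] [DecidableEq m] [DecidableEq k]

theorem SufficientFor.moreInformative_comp {R : QuantumStatisticalModel Θ n}
    {S : QuantumStatisticalModel Θ m} (h : R.SufficientFor S) (T : QuantumStatisticalModel Ξ k) :
    (T.comp R).MoreInformative (T.comp S) := by
  obtain ⟨E, htr, hE⟩ := h
  intro X _ _ ℓ
  obtain ⟨Q, hQ, hmax⟩ := ((T.comp S).maxPayoff_isGreatest ℓ).1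
  refine hmax ▸ ((T.comp R).maxPayoff_isGreatest ℓ).2
    ⟨_, hQ.linkProduct_choiMatrix E htr, ?_⟩
  simp only [expectedPayoff, comp, ← hE, trace_kronecker_map_mul]

/-- If `R` is more informative than `S`, then the statistics of every measurement on `S` are
reproduced by some measurement on `R`. -/
theorem MoreInformative.exists_isPOVM_trace_eq {R : QuantumStatisticalModel Θ n}
    {S : QuantumStatisticalModel Θ m} (h : R.MoreInformative S) {X : Type} [Fintype X] [Nonempty X]
    {Q : X → Matrix m m ℂ} (hQ : IsPOVM Q) :
    ∃ P : X → Matrix n n ℂ, IsPOVM P ∧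
      ∀ θ i, (R.state θ * P i).trace = (S.state θ * Q i).trace := by
  classical
  have := R.param_nonempty
  let stat : (X → Matrix n n ℂ) →ₗ[ℝ] Θ × X → ℝ :=
    { toFun P p := ((R.state p.1 * P p.2).trace).re
      map_add' _ _ := by
        ext
        simp [mul_add]
      map_smul' _ _ := by
        ext
        simp }
  let q : Θ × X → ℝ := fun p => ((S.state p.1 * Q p.2).trace).re
  by_cases hq : q ∈ stat '' {P | IsPOVM P}
  · obtain ⟨P, hP, hPq⟩ := hq
    refine ⟨P, hP, fun θ i => Complex.ext (congrFun hPq (θ, i)) ?_⟩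
    rw [(R.posSemidef θ).trace_mul_im_eq_zero (hP.posSemidef i),
      (S.posSemidef θ).trace_mul_im_eq_zero (hQ.posSemidef i)]
  · exfalso
    have hcont : Continuous stat := by
      change Continuous fun (P : X → Matrix n n ℂ) (p : Θ × X) => ((R.state p.1 * P p.2).trace).re
      fun_prop
    obtain ⟨f, u, hlt, hu⟩ := geometric_hahn_banach_closed_point
      (IsPOVM.convex.linear_image stat) (IsPOVM.isCompact.image hcont).isClosed hq
    -- The coefficients of the separating functional form a payoff function on which `Q` would beat
    -- every POVM on `R`.
    let ℓ : Θ → X → ℝ := fun θ i => f (Pi.single (θ, i) 1)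
    have hf : ∀ g : Θ × X → ℝ, f g = ∑ θ, ∑ i, ℓ θ i * g (θ, i) := by
      intro g
      conv_lhs => rw [← Finset.univ_sum_single g, map_sum, Fintype.sum_prod_type]
      refine Finset.sum_congr rfl fun θ _ => Finset.sum_congr rfl fun i _ => ?_
      have : (Pi.single (θ, i) (g (θ, i)) : Θ × X → ℝ) = g (θ, i) • Pi.single (θ, i) 1 := by
        rw [← Pi.single_smul, smul_eq_mul, mul_one]
      rw [this, map_smul, smul_eq_mul, mul_comm]
    obtain ⟨P, hP, hPmax⟩ := (R.maxPayoff_isGreatest ℓ).1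
    have h₁ : S.expectedPayoff ℓ Q ≤ R.expectedPayoff ℓ P :=
      ((S.maxPayoff_isGreatest ℓ).2 ⟨Q, hQ, rfl⟩).trans ((h X ℓ).trans hPmax.le)
    have h₂ : f q ≤ f (stat P) := by
      rw [hf, hf]
      exact le_of_mul_le_mul_left h₁ (by positivity)
    linarith [hlt _ ⟨P, hP, rfl⟩]

omit [DecidableEq k] in
theorem IsComplete.span_range_state {T : QuantumStatisticalModel Ξ k} (hT : T.IsComplete) :
    Submodule.span ℂ (Set.range T.state) = ⊤ := by
  obtain ⟨f, hf, hind⟩ := hT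
  rw [eq_top_iff, ← hind.span_eq_top_of_card_eq_finrank' (by
    rw [Fintype.card_fin, Module.finrank_matrix, Module.finrank_self, mul_one, sq])]
  exact Submodule.span_mono (Set.range_subset_iff.2 hf)

theorem IsComplete.trace_kronecker_mul_eq {T : QuantumStatisticalModel Ξ k} (hT : T.IsComplete)
    {ρ : Matrix n n ℂ} {σ : Matrix m m ℂ} {P : Matrix (k × n) (k × n) ℂ}
    {Q : Matrix (k × m) (k × m) ℂ}
    (h : ∀ ξ, ((T.state ξ ⊗ₖ ρ) * P).trace = ((T.state ξ ⊗ₖ σ) * Q).trace) (A : Matrix k k ℂ) :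
    ((A ⊗ₖ ρ) * P).trace = ((A ⊗ₖ σ) * Q).trace := by
  have hA : A ∈ Submodule.span ℂ (Set.range T.state) := hT.span_range_state ▸ Submodule.mem_top
  induction hA using Submodule.span_induction with
  | mem _ hx =>
    obtain ⟨ξ, rfl⟩ := hx
    exact h ξ
  | zero => simp
  | add _ _ _ _ h₁ h₂ => simp only [Matrix.add_kronecker, add_mul, Matrix.trace_add, h₁, h₂]
  | smul c _ _ h₁ => simp only [Matrix.smul_kronecker, Matrix.smul_mul, Matrix.trace_smul, h₁]

/-- Positive matrices span, and each is zero or a multiple of a density matrix. -/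
theorem span_posSemidef_trace_eq_one :
    Submodule.span ℂ {A : Matrix n n ℂ | A.PosSemidef ∧ A.trace = 1} = ⊤ := by
  rw [eq_top_iff, ← CStarAlgebra.span_nonneg (A := Matrix n n ℂ), Submodule.span_le]
  intro A hA
  have hA' : A.PosSemidef := Matrix.nonneg_iff_posSemidef.1 hA
  by_cases h0 : A.trace = 0
  · rw [hA'.trace_eq_zero_iff.1 h0]
    exact zero_mem _
  · have hmem : A.trace⁻¹ • A ∈ {A : Matrix n n ℂ | A.PosSemidef ∧ A.trace = 1} :=
      ⟨hA'.smul (inv_nonneg.2 hA'.trace_nonneg), by simp [h0]⟩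
    have := Submodule.smul_mem _ A.trace (Submodule.subset_span (R := ℂ) hmem)
    rwa [smul_smul, mul_inv_cancel₀ h0, one_smul] at this

theorem exists_isComplete (n : Type*) [Fintype n] [DecidableEq n] [Nonempty n] :
    ∃ T : QuantumStatisticalModel (Fin (Fintype.card n ^ 2)) n, T.IsComplete := by
  have hdim : Module.finrank ℂ (Submodule.span ℂ
      {A : Matrix n n ℂ | A.PosSemidef ∧ A.trace = 1}) = Fintype.card n ^ 2 := by
    rw [span_posSemidef_trace_eq_one, finrank_top, Module.finrank_matrix, Module.finrank_self,
      mul_one, sq]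
  have h := Submodule.exists_fun_fin_finrank_span_eq ℂ
    {A : Matrix n n ℂ | A.PosSemidef ∧ A.trace = 1}
  rw [hdim] at h
  obtain ⟨f, hf, -, hind⟩ := h
  exact ⟨⟨⟨⟨0, by positivity⟩⟩, f, fun i => (hf i).1, fun i => (hf i).2⟩, f,
    fun i => ⟨i, rfl⟩, hind⟩

end QuantumStatisticalModel

/-! ### Bell measurement and teleportation. -/

section Teleportation

variable {G k n m : Type*} [AddCommGroup G] [Fintype G] [DecidableEq G]
  [Fintype k] [Fintype n] [Fintype m] [DecidableEq k] [DecidableEq n] [DecidableEq m]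

omit [Fintype G] [DecidableEq G] in
theorem AddChar.apply_mul_star_apply [Finite G] (χ : AddChar G ℂ) (x : G) :
    χ x * star (χ x) = 1 := by
  rw [Complex.star_def, ← AddChar.map_neg_eq_conj, ← AddChar.map_add_eq_mul, add_neg_cancel,
    AddChar.map_zero_eq_one]

/-- The vector representing the generalized Pauli operator with shift `a` and phase `χ`. -/
def bellVector (ek : k ≃ G) (em : m ≃ G) (i : G × AddChar G ℂ) (p : k × m) : ℂ :=
  if em p.2 = ek p.1 + i.1 then i.2 (ek p.1) else 0

/-- The generalized Bell measurement on two systems whose bases are indexed by an abelian group. -/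
noncomputable def bellPOVM (ek : k ≃ G) (em : m ≃ G) (i : G × AddChar G ℂ) :
    Matrix (k × m) (k × m) ℂ :=
  (Fintype.card G : ℂ)⁻¹ • Matrix.vecMulVec (bellVector ek em i) (star (bellVector ek em i))

theorem isPOVM_bellPOVM (ek : k ≃ G) (em : m ≃ G) : IsPOVM (bellPOVM ek em) where
  posSemidef i := (Matrix.posSemidef_vecMulVec_self_star _).smul (by positivity)
  sum_eq_one := by
    have hd : (Fintype.card G : ℂ) ≠ 0 := Nat.cast_ne_zero.2 Fintype.card_ne_zero
    ext ⟨x, y⟩ ⟨x', y'⟩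
    -- Character orthogonality forces `x = x'`; the common shift then forces `y = y'`.
    have hχ : ∑ χ : AddChar G ℂ, χ (ek x) * star (χ (ek x')) =
        if x = x' then (Fintype.card G : ℂ) else 0 := by
      simp only [Complex.star_def, ← AddChar.map_neg_eq_conj, ← AddChar.map_add_eq_mul,
        ← sub_eq_add_neg]
      rw [AddChar.sum_apply_eq_ite]
      simp [sub_eq_zero]
    have hterm : ∀ (a : G) (χ : AddChar G ℂ), bellPOVM ek em (a, χ) (x, y) (x', y') =
        if a = em y - ek x then if em y' = ek x' + a then
          (Fintype.card G : ℂ)⁻¹ * (χ (ek x) * star (χ (ek x'))) else 0 else 0 := by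
      intro a χ
      have h : em y = ek x + a ↔ a = em y - ek x := by
        rw [eq_sub_iff_add_eq, add_comm a, eq_comm]
      simp only [bellPOVM, Matrix.smul_apply, Matrix.vecMulVec_apply, Pi.star_apply, bellVector,
        h, smul_eq_mul]
      split_ifs <;> simp
    rw [Matrix.sum_apply, Fintype.sum_prod_type]
    simp only [hterm, Finset.sum_ite_irrel, ← Finset.mul_sum, hχ, Finset.sum_const_zero,
      Finset.sum_ite_eq', Finset.mem_univ, if_true, Matrix.one_apply, Prod.mk.injEq]
    by_cases hx : x = x'
    · subst hx
      simp [hd, eq_comm]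
    · simp [hx]

/-- Every Bell outcome reads off the entry `σ y y'` up to a phase, which the correction cancels. -/
theorem trace_single_kronecker_mul_bellPOVM (ek : k ≃ G) (em : m ≃ G) (a : G) (χ : AddChar G ℂ)
    (σ : Matrix m m ℂ) (y y' : m) :
    ((Matrix.single (ek.symm (em y - a)) (ek.symm (em y' - a)) 1 ⊗ₖ σ) *
        bellPOVM ek em (a, χ)).trace =
      (Fintype.card G : ℂ)⁻¹ * (σ y y' * (χ (em y' - a) * star (χ (em y - a)))) := by
  rw [trace_kronecker_mul]
  have h : ∀ w v : m, em w = em v - a + a ↔ w = v := by simp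
  simp only [Matrix.single_apply, ite_and, ite_mul, one_mul, zero_mul, Finset.sum_ite_eq,
    Finset.mem_univ, if_true, bellPOVM, Matrix.smul_apply, Matrix.vecMulVec_apply, Pi.star_apply,
    bellVector, Equiv.apply_symm_apply, h, smul_eq_mul, apply_ite star, star_zero, mul_ite,
    mul_zero, Finset.sum_ite_irrel, Finset.sum_const_zero, Finset.sum_ite_eq']
  ring

/-- The Choi matrix of the channel which measures `P` jointly on its input and on one half of a
maximally entangled pair, and then corrects the other half according to the outcome. -/
noncomputable def teleportationChoi (ek : k ≃ G) (em : m ≃ G)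
    (P : G × AddChar G ℂ → Matrix (k × n) (k × n) ℂ) : Matrix (m × n) (m × n) ℂ :=
  (Fintype.card G : ℂ)⁻¹ • ∑ i : G × AddChar G ℂ, Matrix.of fun p q =>
    i.2 (em p.1 - i.1) *
      P i (ek.symm (em q.1 - i.1), q.2) (ek.symm (em p.1 - i.1), p.2) *
      star (i.2 (em q.1 - i.1))

omit [DecidableEq G] [DecidableEq m] in
theorem IsPOVM.posSemidef_teleportationChoi (ek : k ≃ G) (em : m ≃ G)
    {P : G × AddChar G ℂ → Matrix (k × n) (k × n) ℂ} (hP : IsPOVM P) :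
    (teleportationChoi ek em P).PosSemidef := by
  refine (Matrix.posSemidef_sum _ fun i _ => ?_).smul (by positivity)
  exact (((hP.posSemidef i).transpose.submatrix
    fun p : m × n => (ek.symm (em p.1 - i.1), p.2))).mul_mul_star fun p => i.2 (em p.1 - i.1)

omit [DecidableEq G] [Fintype m] [DecidableEq n] [DecidableEq m] in
theorem linearMapOfChoi_teleportationChoi_apply (ek : k ≃ G) (em : m ≃ G)
    (P : G × AddChar G ℂ → Matrix (k × n) (k × n) ℂ) (A : Matrix n n ℂ) (y y' : m) :
    linearMapOfChoi (teleportationChoi ek em P) A y y' =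
      (Fintype.card G : ℂ)⁻¹ * ∑ i : G × AddChar G ℂ,
        i.2 (em y - i.1) * star (i.2 (em y' - i.1)) *
        ((Matrix.single (ek.symm (em y - i.1)) (ek.symm (em y' - i.1)) 1 ⊗ₖ A) * P i).trace := by
  simp only [trace_kronecker_mul, Matrix.single_apply, ite_and, ite_mul, one_mul, zero_mul,
    Finset.sum_ite_irrel, Finset.sum_const_zero, Finset.sum_ite_eq, Finset.mem_univ, if_true]
  change ∑ z, ∑ z', A z z' * teleportationChoi ek em P (y, z) (y', z') = _
  simp only [teleportationChoi, Matrix.smul_apply, Matrix.sum_apply, Matrix.of_apply, smul_eq_mul,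
    Finset.mul_sum]
  rw [Finset.sum_congr rfl fun z _ => Finset.sum_comm, Finset.sum_comm]
  refine Finset.sum_congr rfl fun i _ => Finset.sum_congr rfl fun z _ =>
    Finset.sum_congr rfl fun z' _ => ?_
  ring

omit [DecidableEq G] [DecidableEq m] in
-- On the diagonal the phases cancel and shifts permute the basis, leaving `|G|⁻¹ Tr(1 ⊗ A)`.
theorem IsPOVM.trace_linearMapOfChoi_teleportationChoi (ek : k ≃ G) (em : m ≃ G)
    {P : G × AddChar G ℂ → Matrix (k × n) (k × n) ℂ} (hP : IsPOVM P) (A : Matrix n n ℂ) :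
    (linearMapOfChoi (teleportationChoi ek em P) A).trace = A.trace := by
  have hd : (Fintype.card G : ℂ) ≠ 0 := Nat.cast_ne_zero.2 Fintype.card_ne_zero
  have hcard : Fintype.card k = Fintype.card G := Fintype.card_congr ek
  rw [Matrix.trace]
  simp only [Matrix.diag_apply, linearMapOfChoi_teleportationChoi_apply,
    AddChar.apply_mul_star_apply, one_mul]
  rw [← Finset.mul_sum, Finset.sum_comm]
  have hreindex : ∀ i : G × AddChar G ℂ,
      ∑ y, ((Matrix.single (ek.symm (em y - i.1)) (ek.symm (em y - i.1)) 1 ⊗ₖ A) * P i).trace =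
        ∑ x, ((Matrix.single x x 1 ⊗ₖ A) * P i).trace := fun i =>
    Equiv.sum_comp ((em.trans (Equiv.subRight i.1)).trans ek.symm)
      fun x => ((Matrix.single x x 1 ⊗ₖ A) * P i).trace
  simp only [hreindex]
  rw [Finset.sum_comm]
  simp only [← Matrix.trace_sum, ← Finset.mul_sum, hP.sum_eq_one, mul_one, Matrix.trace_kronecker,
    Matrix.trace_single_eq_same, one_mul, Finset.sum_const, Finset.card_univ, hcard]
  rw [Matrix.trace_smul, nsmul_eq_mul, inv_mul_cancel_left₀ hd]

omit [DecidableEq n] in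
theorem linearMapOfChoi_teleportationChoi_eq (ek : k ≃ G) (em : m ≃ G)
    {P : G × AddChar G ℂ → Matrix (k × n) (k × n) ℂ} {ρ : Matrix n n ℂ} {σ : Matrix m m ℂ}
    (h : ∀ i (A : Matrix k k ℂ),
      ((A ⊗ₖ ρ) * P i).trace = ((A ⊗ₖ σ) * bellPOVM ek em i).trace) :
    linearMapOfChoi (teleportationChoi ek em P) ρ = σ := by
  have hd : (Fintype.card G : ℂ) ≠ 0 := Nat.cast_ne_zero.2 Fintype.card_ne_zero
  ext y y'
  rw [linearMapOfChoi_teleportationChoi_apply]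
  have hterm : ∀ i : G × AddChar G ℂ, i.2 (em y - i.1) * star (i.2 (em y' - i.1)) *
      ((Matrix.single (ek.symm (em y - i.1)) (ek.symm (em y' - i.1)) 1 ⊗ₖ ρ) * P i).trace =
        (Fintype.card G : ℂ)⁻¹ * σ y y' := by
    rintro ⟨a, χ⟩
    rw [h, trace_single_kronecker_mul_bellPOVM]
    -- With `u = v = 1` the two phase identities, `v * u - 1 = v * (u - 1) + (v - 1)`.
    linear_combination (Fintype.card G : ℂ)⁻¹ * σ y y' *
      (χ (em y' - a) * star (χ (em y' - a)) * χ.apply_mul_star_apply (em y - a) +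
        χ.apply_mul_star_apply (em y' - a))
  -- The `|G|²` outcomes cancel the two factors `|G|⁻¹`.
  rw [Finset.sum_congr rfl fun i _ => hterm i, Finset.sum_const, Finset.card_univ,
    Fintype.card_prod, AddChar.card_eq, nsmul_eq_mul]
  push_cast
  field_simp

end Teleportation

/-! ### The equivalence. -/

theorem QuantumStatisticalModel.nonempty_index {Θ n : Type*} [Fintype Θ] [Fintype n]
    (R : QuantumStatisticalModel Θ n) : Nonempty n := by
  obtain ⟨θ⟩ := R.param_nonempty
  by_contra hn
  rw [not_nonempty_iff] at hn
  simpa [Matrix.trace] using R.trace_eq_one θ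

theorem QuantumStatisticalModel.IsComplete.sufficientFor {Θ Ξ n m k : Type*} [Fintype Θ]
    [Fintype Ξ] [Fintype n] [Fintype m] [Fintype k] [DecidableEq n] [DecidableEq m]
    [DecidableEq k] {T : QuantumStatisticalModel Ξ k} (hT : T.IsComplete) (e : k ≃ m)
    {R : QuantumStatisticalModel Θ n} {S : QuantumStatisticalModel Θ m}
    (h : (T.comp R).MoreInformative (T.comp S)) : R.SufficientFor S := by
  have := S.nonempty_index
  have : NeZero (Fintype.card m) := ⟨Fintype.card_ne_zero⟩
  -- Any abelian group of order `dim ℋ'` would do; the cyclic one always exists.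
  let em : m ≃ ZMod (Fintype.card m) := Fintype.equivOfCardEq (ZMod.card _).symm
  let ek := e.trans em
  obtain ⟨P, hP, htr⟩ := h.exists_isPOVM_trace_eq (isPOVM_bellPOVM ek em)
  exact ⟨completelyPositiveMapOfChoi _ (hP.posSemidef_teleportationChoi ek em),
    hP.trace_linearMapOfChoi_teleportationChoi ek em,
    fun θ => linearMapOfChoi_teleportationChoi_eq ek em fun i =>
      hT.trace_kronecker_mul_eq fun ξ => htr (ξ, θ) i⟩

theorem mainTheorem4 {Θ n m : Type*} [Fintype Θ]
    [Fintype n] [DecidableEq n] [Fintype m] [DecidableEq m]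
    (R : QuantumStatisticalModel Θ n) (S : QuantumStatisticalModel Θ m) :
    List.TFAE [
      R.SufficientFor S,
      ∀ (Ξ k : Type) [Fintype Ξ] [Fintype k] [DecidableEq k] (T : QuantumStatisticalModel Ξ k),
        (T.comp R).MoreInformative (T.comp S),
      ∃ (Ξ k : Type) (_ : Fintype Ξ) (_ : Fintype k) (_ : DecidableEq k)
        (T : QuantumStatisticalModel Ξ k),
        T.IsComplete ∧ Nonempty (k ≃ m) ∧ (T.comp R).MoreInformative (T.comp S)] := by
  tfae_have 1 → 2 := fun h _ _ _ _ _ T => h.moreInformative_comp T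
  tfae_have 2 → 3 := fun h => by
    have := S.nonempty_index
    have : NeZero (Fintype.card m) := ⟨Fintype.card_ne_zero⟩
    -- `Fin` replaces `m`, which may live in a higher universe than `Type`.
    obtain ⟨T, hT⟩ := QuantumStatisticalModel.exists_isComplete (Fin (Fintype.card m))
    exact ⟨_, _, _, _, _, T, hT, ⟨(Fintype.equivFin m).symm⟩, h _ _ T⟩
  tfae_have 3 → 1 := by
    rintro ⟨Ξ, k, _, _, _, T, hT, ⟨e⟩, h⟩
    exact hT.sufficientFor e h
  tfae_finish
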